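/- **Theorem (Schnol's theorem for the three-dimensional massless Dirac operator).** Let $$\sigma_1=\begin{pmatrix}0&1\\1&0\end{pmatrix},\quad \sigma_2=\begin{pmatrix}0&-i\\i&0\end{pmatrix},\quad \sigma_3=\begin{pmatrix}1&0\\0&-1\end{pmatrix},\qquad \alpha_j=\begin{pmatrix}0&\sigma_j\\ \sigma_j&0\end{pmatrix}\ (j=1,2,3),$$ and $\alpha\cdot\nabla=\sum_{j=1}^3\alpha_j\,\partial/\partial x_j$. Let $q\in L^2_{\mathrm{loc}}(\mathbb R^3,\mathbb R)$ and let $\lambda\in\mathbb R$. Suppose that $f:\mathbb R^3\to\mathbb C^4$ is measurable, does not vanish almost everywhere, is polynomially bounded, i.e. there are $C\in\mathbb R$ and $N\in\mathbb N$ with $|f(x)|\le C(1+|x|)^N$ for almost every $x$, and satisfies $$(-i\,\alpha\cdot\nabla+q)f=\lambda f$$ in the sense of distributions on $\mathbb R^3$. Let $H_3$ be any self-adjoint realization of $-i\,\alpha\cdot\nabla+q$ in $L^2(\mathbb R^3;\mathbb C^4)$, i.e. a self-adjoint operator in $L^2(\mathbb R^3;\mathbb C^4)$ with $H_3u=(-i\,\alpha\cdot\nabla+q)u$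 in the sense of distributions for all $u\in\mathrm{Dom}(H_3)$, such that $$\mathrm{Dom}(H_3)\supset H^1(\mathbb R^3;\mathbb C^4)\cap \mathrm{Dom}(q),\qquad \mathrm{Dom}(q)=\{u\in L^2(\mathbb R^3;\mathbb C^4)\mid qu\in L^2(\mathbb R^3;\mathbb C^4)\}.$$ Then $\lambda\in\sigma(H_3)$. -/

import Mathlib

open MeasureTheory
open scoped Distributions LineDeriv

noncomputable section

namespace MasslessDirac

/-- Position space `ℝ³` with its Euclidean norm. -/
abbrev Space : Type := EuclideanSpace ℝ (Fin 3)

/-- Spinor space `ℂ⁴` with its Hermitian norm. -/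
abbrev Spinor : Type := EuclideanSpace ℂ (Fin 4)

/-- The Hilbert space `L²(ℝ³; ℂ⁴)`. -/
abbrev L2 : Type := Lp Spinor 2 (volume : Measure Space)

/-- The Pauli matrices `σ₁, σ₂, σ₃`, indexed by `0, 1, 2`. -/
def pauli : Fin 3 → Matrix (Fin 2) (Fin 2) ℂ :=
  ![!![0, 1; 1, 0], !![0, -Complex.I; Complex.I, 0], !![1, 0; 0, -1]]

/-- The Dirac matrices `αⱼ`, with zero diagonal blocks and both off-diagonal blocks equal
to `σⱼ`. -/
def alpha (j : Fin 3) : Matrix (Fin 4) (Fin 4) ℂ :=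
  Matrix.reindex finSumFinEquiv finSumFinEquiv (Matrix.fromBlocks 0 (pauli j) (pauli j) 0)

/-- Multiplication of spinors by a `4 × 4` matrix, as a continuous real-linear map. -/
def matMul (A : Matrix (Fin 4) (Fin 4) ℂ) : Spinor →L[ℝ] Spinor :=
  (Matrix.toEuclideanCLM (n := Fin 4) (𝕜 := ℂ) A).restrictScalars ℝ

/-- `ℂ⁴`-valued distributions on `ℝ³`. -/
abbrev SpinorDistribution : Type := 𝓓'((⊤ : TopologicalSpace.Opens Space), Spinor)

/-- The distribution `φ ↦ ∫ φ g` defined by a locally integrable spinor field `g`. -/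
def toDistribution (g : Space → Spinor) : SpinorDistribution :=
  ContinuousLinearMap.toUniformConvergenceCLM (RingHom.id ℝ) Spinor _
    (TestFunction.integralAgainstBilinCLM (ContinuousLinearMap.lsmul ℝ ℝ) volume g)

/-- The distribution `(-i α·∇ + q) g = ∑ⱼ -i αⱼ ∂ⱼ g + q g`, for spinor fields `g` such that `g`
and `q g` are locally integrable. -/
def diracExpr (q : Space → ℝ) (g : Space → Spinor) : SpinorDistribution :=
  ∑ j : Fin 3, Distribution.mapCLM (matMul (-Complex.I • alpha j))
      (∂_{EuclideanSpace.single j (1 : ℝ)} (toDistribution g))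
    + toDistribution (fun x => q x • g x)

/-- `q ∈ L²_loc(ℝ³; ℝ)`. -/
def IsL2Loc (q : Space → ℝ) : Prop :=
  ∀ K : Set Space, IsCompact K → MemLp q 2 (volume.restrict K)

/-- Polynomial boundedness (up to null sets): `|f(x)| ≤ C (1 + |x|)^N` for some `C` and `N`. -/
def IsPolynomiallyBounded (f : Space → Spinor) : Prop :=
  ∃ (C : ℝ) (N : ℕ), ∀ᵐ x : Space, ‖f x‖ ≤ C * (1 + ‖x‖) ^ N

/-- `u ∈ H¹(ℝ³; ℂ⁴)`, for `u ∈ L²(ℝ³; ℂ⁴)`. -/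
def MemH1 (u : L2) : Prop :=
  TemperedDistribution.MemSobolev 1 2 (Lp.toTemperedDistribution u)

/-- `u ∈ Dom(q)`, the domain of the maximal multiplication operator by `q` in
`L²(ℝ³; ℂ⁴)`. -/
def MemDomMul (q : Space → ℝ) (u : L2) : Prop :=
  MemLp (fun x => q x • u x) 2 (volume : Measure Space)

/-- `H` is a self-adjoint realization of `-i α·∇ + q` in `L²(ℝ³; ℂ⁴)`: it is a self-adjoint
operator, and acts on each element of its domain by the differential expression, taken in the
sense of distributions. Whenever the domain of `H` contains the test functions, the second
condition is equivalent, for self-adjoint `H` and `q ∈ L²_loc`, to `H` extending the operator `-i α·∇ + q` on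
`C₀^∞(ℝ³; ℂ⁴)`. -/
structure IsSelfAdjointRealization (q : Space → ℝ) (H : L2 →ₗ.[ℂ] L2) : Prop where
  isSelfAdjoint : IsSelfAdjoint H
  apply_eq : ∀ u : H.domain, toDistribution (H u) = diracExpr q (u : L2)

/-- `z` lies in the resolvent set of the operator `H`: the operator `H - z`, defined on the domain
of `H`, has an everywhere defined bounded two-sided inverse `R`. -/
def InResolventSet (H : L2 →ₗ.[ℂ] L2) (z : ℂ) : Prop :=
  ∃ R : L2 →L[ℂ] L2,
    (∀ v : L2, ∃ h : R v ∈ H.domain, H ⟨R v, h⟩ - z • R v = v) ∧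
      ∀ u : H.domain, R (H u - z • (u : L2)) = u

/-- The spectrum of a (possibly unbounded) operator in `L²(ℝ³; ℂ⁴)`. -/
def opSpectrum (H : L2 →ₗ.[ℂ] L2) : Set ℂ :=
  {z | ¬ InResolventSet H z}

end MasslessDirac

end

noncomputable section

namespace MasslessDirac

/-! ### Clifford relations and elliptic regularity -/

section Sobolev

open scoped SchwartzMap Laplacian ENNReal Real

/-! Suppose `λ` were in the resolvent set, with resolvent `R`. For a smooth compactly supported `χ`,
the field `u = χ f` satisfies `(-i α·∇ + q - λ) u = -i (α·∇χ) f`. Since `f` is locally bounded and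
`q` is locally `L²`, both `u` and `-i α·∇ u` lie in `L²`, so `u ∈ H¹` by ellipticity
(`memH1_of_dirac`) and `u ∈ Dom(q)`; hence `u ∈ Dom(H)`. Applying `R` gives `‖χ f‖ ≤ ‖R‖ ‖(α·∇χ) f‖`
with a constant independent of `χ` (`exists_eLpNorm_cutoff_le`).

Take `χ = 1` on the ball of radius `r ≥ 1`, with gradient `O(1/r)` supported in the ball of radius
`2r`. The local norm `J(r)` of `f` then satisfies `J(r) ≤ (A/r) J(2r)`. Iteration gains arbitrary
powers of `1/r` and beats the polynomial growth of `J`, so the nondecreasing `J` vanishes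
(`eq_zero_of_le_div_mul_double`) and `f = 0` almost everywhere, a contradiction. -/

lemma pauli_anticomm (j k : Fin 3) :
    pauli j * pauli k + pauli k * pauli j = (if j = k then (2 : ℂ) else 0) • 1 := by
  fin_cases j <;> fin_cases k <;> ext a b <;> fin_cases a <;> fin_cases b <;>
    simp [pauli] <;> norm_num

/-- Products of two off-diagonal block matrices are block diagonal, which reduces the claim to the
Pauli matrices. -/
lemma alpha_anticomm (j k : Fin 3) :
    alpha j * alpha k + alpha k * alpha j = (if j = k then (2 : ℂ) else 0) • 1 := by
  have h : ∀ j k, alpha j * alpha k = Matrix.reindex finSumFinEquiv finSumFinEquiv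
      (Matrix.fromBlocks (pauli j * pauli k) 0 0 (pauli j * pauli k)) := by
    intro j k
    simp [alpha, Matrix.submatrix_mul_equiv, Matrix.fromBlocks_multiply]
  rw [h, h]
  have hp := pauli_anticomm j k
  simp only [Matrix.reindex_apply]
  have hs : ∀ A B : Matrix (Fin 2 ⊕ Fin 2) (Fin 2 ⊕ Fin 2) ℂ,
      A.submatrix finSumFinEquiv.symm finSumFinEquiv.symm +
        B.submatrix finSumFinEquiv.symm finSumFinEquiv.symm =
        (A + B).submatrix finSumFinEquiv.symm finSumFinEquiv.symm := fun _ _ => rfl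
  rw [hs, Matrix.fromBlocks_add, hp, add_zero,
    show Matrix.fromBlocks (((if j = k then (2 : ℂ) else 0) • 1 : Matrix (Fin 2) (Fin 2) ℂ)) 0 0
      ((if j = k then (2 : ℂ) else 0) • 1) = (if j = k then (2 : ℂ) else 0) • 1 by
      rw [← Matrix.fromBlocks_one, Matrix.fromBlocks_smul, smul_zero]]
  ext a b
  simp only [Matrix.submatrix_apply, Matrix.smul_apply, Matrix.one_apply, Equiv.apply_eq_iff_eq]

/-- Multiplication of spinors by `-i αⱼ`. -/
def diracCLM (j : Fin 3) : Spinor →L[ℂ] Spinor :=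
  Matrix.toEuclideanCLM (n := Fin 4) (𝕜 := ℂ) (-Complex.I • alpha j)

lemma diracCLM_anticomm (j k : Fin 3) (v : Spinor) :
    diracCLM j (diracCLM k v) + diracCLM k (diracCLM j v) =
      (if j = k then (-2 : ℂ) else 0) • v := by
  have h : (-Complex.I • alpha j) * (-Complex.I • alpha k) +
      (-Complex.I • alpha k) * (-Complex.I • alpha j) =
      (if j = k then (-2 : ℂ) else 0) • (1 : Matrix (Fin 4) (Fin 4) ℂ) := by
    simp only [Matrix.smul_mul, Matrix.mul_smul, smul_smul, ← smul_add, alpha_anticomm]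
    rw [neg_mul_neg, Complex.I_mul_I]
    split_ifs <;> simp
  have h2 := congrArg (fun A => Matrix.toEuclideanCLM (n := Fin 4) (𝕜 := ℂ) A v) h
  rw [map_add, map_mul, map_mul, map_smul (Matrix.toEuclideanCLM (n := Fin 4) (𝕜 := ℂ)) (ite _ _ _),
    map_one] at h2
  exact h2

lemma schwartz_lineDeriv_comm (φ : 𝓢(Space, ℂ)) (a b : Space) :
    ∂_{a} (∂_{b} φ) = ∂_{b} (∂_{a} φ) := by
  have h : ∀ a b x, (∂_{a} (∂_{b} φ) : 𝓢(Space, ℂ)) x = fderiv ℝ (fderiv ℝ φ) x a b := by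
    intro a b x
    have hf : (⇑(∂_{b} φ : 𝓢(Space, ℂ))) = fun x => fderiv ℝ φ x b := by
      ext x
      rw [SchwartzMap.lineDerivOp_apply_eq_fderiv]
    rw [SchwartzMap.lineDerivOp_apply_eq_fderiv, hf, fderiv_clm_apply]
    · simp
    · exact ((φ.smooth 2).fderiv_right (m := 1) (by norm_num)).differentiable (by norm_num) x
    · fun_prop
  ext x
  rw [h, h]
  exact ((φ.smooth 2).contDiffAt.isSymmSndFDerivAt (by simp)).eq a b

/-- A constant matrix acts on values only, so it commutes with the Bessel potential and preserves
`L²`. -/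
lemma memSobolev_postcomp {s : ℝ} {T : 𝓢'(Space, Spinor)} (A : Spinor →L[ℂ] Spinor)
    (hT : TemperedDistribution.MemSobolev s 2 T) :
    TemperedDistribution.MemSobolev s 2 (PointwiseConvergenceCLM.postcomp 𝓢(Space, ℂ) A T) := by
  obtain ⟨g, hg⟩ := hT
  refine ⟨A.compLp g, ?_⟩
  ext1 φ
  have h1 : TemperedDistribution.besselPotential Space Spinor s
      (PointwiseConvergenceCLM.postcomp 𝓢(Space, ℂ) A T) φ =
      A (TemperedDistribution.besselPotential Space Spinor s T φ) := rfl
  rw [h1, hg, Lp.toTemperedDistribution_apply, Lp.toTemperedDistribution_apply,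
    ← A.integral_comp_comm]
  · refine integral_congr_ae ?_
    filter_upwards [A.coeFn_compLp g] with x hx
    simp [hx]
  · exact memLp_one_iff_integrable.1 ((Lp.memLp g).smul (φ.memLp 2))

/-- The symbol is `1 + |ξ|²`; with the Fourier kernel `exp(-2πi x·ξ)`, `|ξ|²` corresponds to
`-Δ/(2π)²`. -/
lemma besselPotential_two {F : Type*} [NormedAddCommGroup F] [NormedSpace ℂ F]
    (T : 𝓢'(Space, F)) :
    TemperedDistribution.besselPotential Space F 2 T =
      T - (((2 * π) ^ 2)⁻¹ : ℝ) • Δ T := by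
  have h : TemperedDistribution.besselPotential Space F 2 =
      TemperedDistribution.fourierMultiplierCLM F (fun _ : Space => (1 : ℂ)) +
      TemperedDistribution.fourierMultiplierCLM F
        (fun x : Space => Complex.ofReal (‖x‖ ^ 2)) := by
    ext T φ
    simp only [TemperedDistribution.besselPotential, add_apply,
      TemperedDistribution.fourierMultiplierCLM_apply_apply]
    rw [← map_add, ← FourierTransform.fourier_add, ← add_apply,
      ← SchwartzMap.smulLeftCLM_add (by fun_prop) (by fun_prop)]
    congr
    ext x
    simp
  rw [h, TemperedDistribution.laplacian_eq_fourierMultiplierCLM]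
  simp [smul_smul]

/-- Interior elliptic regularity on the whole space: `u` and `-i α·∇ u` in `L²` give `u ∈ H¹`. -/
theorem memH1_of_dirac {u w : L2}
    (h : ∀ φ : 𝓢(Space, ℂ), Lp.toTemperedDistribution w φ =
      ∑ j : Fin 3, diracCLM j
        (Lp.toTemperedDistribution u (-∂_{EuclideanSpace.single j (1 : ℝ)} φ))) :
    MemH1 u := by
  set U : 𝓢'(Space, Spinor) := Lp.toTemperedDistribution u with hU
  set W : 𝓢'(Space, Spinor) := Lp.toTemperedDistribution w with hW
  let e : Fin 3 → Space := fun j => EuclideanSpace.single j (1 : ℝ)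
  -- `V` is the Dirac operator applied to `W`, i.e. twice to `U`. It lies in `H⁻¹`, and the Clifford
  -- relations identify it with `-Δ U`.
  let V : 𝓢'(Space, Spinor) := ∑ k : Fin 3,
    PointwiseConvergenceCLM.postcomp 𝓢(Space, ℂ) (diracCLM k) (∂_{e k} W)
  have hV : TemperedDistribution.MemSobolev (-1) 2 V := by
    have hW0 : TemperedDistribution.MemSobolev 0 2 W :=
      TemperedDistribution.memSobolev_zero_iff.2 ⟨w, rfl⟩
    have hk : ∀ k, TemperedDistribution.MemSobolev (-1) 2
        (PointwiseConvergenceCLM.postcomp 𝓢(Space, ℂ) (diracCLM k) (∂_{e k} W)) := by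
      intro k
      have := hW0.lineDerivOp (m := e k)
      rw [zero_sub] at this
      exact memSobolev_postcomp _ this
    simp only [V, Fin.sum_univ_three]
    exact ((hk 0).add (hk 1)).add (hk 2)
  have hlap : Δ U = -V := by
    ext1 φ
    have hb : ∀ j, EuclideanSpace.basisFun (Fin 3) ℝ j = e j := fun j => by simp [e]
    rw [TemperedDistribution.laplacian_eq_sum (EuclideanSpace.basisFun (Fin 3) ℝ)]
    simp only [hb]
    set B : Fin 3 → Fin 3 → Spinor := fun j k => U (∂_{e j} (∂_{e k} φ)) with hBdef
    have hB : ∀ j k, B j k = B k j := fun j k => by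
      simp only [hBdef]
      rw [schwartz_lineDeriv_comm]
    have hVφ : V φ = ∑ k, diracCLM k (∑ j, diracCLM j (B j k)) := by
      have : V φ = ∑ k, diracCLM k (W (-∂_{e k} φ)) := by
        simp only [V, sum_apply]
        rfl
      rw [this]
      refine Finset.sum_congr rfl fun k _ => ?_
      rw [h]
      simp [B, e, LineDeriv.lineDerivOp_neg]
    have hΔ : (∑ i, ∂_{e i} (∂_{e i} U) : 𝓢'(Space, Spinor)) φ = ∑ i, B i i := by
      simp [Fin.sum_univ_three, B, LineDeriv.lineDerivOp_neg]
    rw [hΔ, neg_apply, hVφ]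
    -- Adding the double sum to its copy with indices swapped produces anticommutators, since `B` is
    -- symmetric; only the diagonal survives.
    have h2 : (2 : ℂ) • ∑ k, diracCLM k (∑ j, diracCLM j (B j k)) = (-2 : ℂ) • ∑ i, B i i := by
      simp only [map_sum]
      rw [two_smul]
      nth_rewrite 2 [Finset.sum_comm]
      simp only [← Finset.sum_add_distrib]
      have : ∀ k j, diracCLM k (diracCLM j (B j k)) + diracCLM j (diracCLM k (B k j)) =
          if k = j then (-2 : ℂ) • B j j else 0 := by
        intro k j
        rw [hB k j, diracCLM_anticomm]
        split_ifs with hkj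
        · rw [hkj]
        · simp
      simp only [this, Finset.smul_sum, Finset.sum_ite_eq, Finset.mem_univ, if_true]
    have h3 := congrArg (fun v => (-(2 : ℂ)⁻¹) • v) h2
    simpa [smul_smul] using h3.symm
  have hU0 : TemperedDistribution.MemSobolev (-1) 2 U :=
    (TemperedDistribution.memSobolev_zero_iff.2 ⟨u, rfl⟩ :
      TemperedDistribution.MemSobolev 0 2 U).mono (by norm_num)
  -- `(1 - Δ/(2π)²) U ∈ H⁻¹`, and inverting this operator gains two orders, whence `U ∈ H¹`.
  have hB : TemperedDistribution.MemSobolev (-1) 2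
      (TemperedDistribution.besselPotential Space Spinor 2 U) := by
    rw [besselPotential_two, hlap]
    refine hU0.sub ?_
    have := (hV.neg).smul ((((2 * π) ^ 2)⁻¹ : ℝ) : ℂ)
    convert this using 1
    ext1 φ
    exact (Complex.coe_smul _ _).symm
  rw [TemperedDistribution.memSobolev_besselPotential_iff] at hB
  norm_num at hB
  exact hB

end Sobolev

/-! ### The cut-off equation in weak form -/

section WeakForm

open scoped SchwartzMap ENNReal NNReal ContDiff

lemma toDistribution_apply {g : Space → Spinor} (hg : LocallyIntegrable g)
    (φ : 𝓓((⊤ : TopologicalSpace.Opens Space), ℝ)) :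
    toDistribution g φ = ∫ x, φ x • g x := by
  change TestFunction.integralAgainstBilinCLM (ContinuousLinearMap.lsmul ℝ ℝ) volume g φ = _
  rw [TestFunction.integralAgainstBilinCLM_eq_integral (hg.locallyIntegrableOn _)]
  rfl

lemma testFunction_lineDeriv_apply (φ : 𝓓((⊤ : TopologicalSpace.Opens Space), ℝ)) (v x : Space) :
    (∂_{v} φ) x = fderiv ℝ φ x v := by
  rw [TestFunction.lineDerivOp_eq_lineDerivCLM ℝ, TestFunction.lineDerivCLM_apply_of_le (by simp),
    DifferentiableAt.lineDeriv_eq_fderiv]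
  exact φ.contDiff.differentiable (by simp) x

lemma diracExpr_apply {q : Space → ℝ} {g : Space → Spinor} (hg : LocallyIntegrable g)
    (hqg : LocallyIntegrable (fun x => q x • g x))
    (φ : 𝓓((⊤ : TopologicalSpace.Opens Space), ℝ)) :
    diracExpr q g φ =
      ∑ j, diracCLM j (∫ x, (-fderiv ℝ φ x (EuclideanSpace.single j (1 : ℝ))) • g x)
        + ∫ x, φ x • q x • g x := by
  have h1 : ∀ j : Fin 3, Distribution.mapCLM (matMul (-Complex.I • alpha j))
      (∂_{EuclideanSpace.single j (1 : ℝ)} (toDistribution g)) φ =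
      diracCLM j (∫ x, (-fderiv ℝ φ x (EuclideanSpace.single j (1 : ℝ))) • g x) := by
    intro j
    rw [Distribution.mapCLM_apply, Distribution.lineDerivOp_apply_apply, toDistribution_apply hg]
    simp only [neg_apply, testFunction_lineDeriv_apply]
    rfl
  rw [diracExpr, add_apply, sum_apply, toDistribution_apply hqg]
  simp only [h1]

/-- The spinor field `-i (α·∇χ) f`. -/
def commutatorField (χ : Space → ℝ) (f : Space → Spinor) (x : Space) : Spinor :=
  ∑ j, diracCLM j (fderiv ℝ χ x (EuclideanSpace.single j (1 : ℝ)) • f x)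

/-- If `(-i α·∇ + q) f = λ f`, then `-i α·∇ (χ f) = (λ - q) χ f - i (α·∇χ) f`, tested against an
arbitrary smooth function. -/
lemma weak_dirac_cutoff {q : Space → ℝ} {lam : ℝ} {f : Space → Spinor} (hf : LocallyIntegrable f)
    (hqf : LocallyIntegrable (fun x => q x • f x))
    (heq : diracExpr q f = lam • toDistribution f)
    {χ : Space → ℝ} (hχ : ContDiff ℝ ∞ χ) (hχc : HasCompactSupport χ)
    {ψ : Space → ℝ} (hψ : ContDiff ℝ ∞ ψ) :
    ∑ j, diracCLM j (∫ x, (-fderiv ℝ ψ x (EuclideanSpace.single j (1 : ℝ))) • χ x • f x) =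
      ∫ x, ψ x • ((lam - q x) • χ x • f x + commutatorField χ f x) := by
  -- The equation for `f` is tested against `χ ψ`, which has compact support even if `ψ` does not;
  -- the Leibniz rule produces the commutator term.
  let φ : 𝓓((⊤ : TopologicalSpace.Opens Space), ℝ) :=
    ⟨fun x => χ x * ψ x, hχ.mul hψ, hχc.mul_right, by simp⟩
  have hφ : ∀ x, φ x = χ x * ψ x := fun _ => rfl
  have hdφ : ∀ x v, fderiv ℝ φ x v = χ x * fderiv ℝ ψ x v + ψ x * fderiv ℝ χ x v := by
    intro x v
    have : (φ : Space → ℝ) = fun x => χ x * ψ x := rfl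
    rw [this, fderiv_fun_mul (hχ.differentiable (by simp) x) (hψ.differentiable (by simp) x)]
    simp
  have hcd : ∀ {ζ : Space → ℝ} (_ : ContDiff ℝ ∞ ζ) (v : Space),
      Continuous fun x => fderiv ℝ ζ x v := fun h v =>
    (h.continuous_fderiv (by simp)).clm_apply continuous_const
  have hint : ∀ {ζ : Space → ℝ} {g : Space → Spinor}, Continuous ζ → HasCompactSupport ζ →
      LocallyIntegrable g → Integrable fun x => ζ x • g x := fun h1 h2 h3 =>
    h3.integrable_smul_left_of_hasCompactSupport h1 h2
  have key := congrArg (fun T : SpinorDistribution => T φ) heq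
  simp only [smul_apply] at key
  rw [diracExpr_apply hf hqf, toDistribution_apply hf] at key
  have i1 : ∀ j : Fin 3, Integrable fun x =>
      (-fderiv ℝ φ x (EuclideanSpace.single j (1 : ℝ))) • f x := by
    intro j
    refine hint (hcd φ.contDiff _).neg ?_ hf
    exact (φ.hasCompactSupport.fderiv_apply (𝕜 := ℝ) _).neg
  have i2 : ∀ j : Fin 3, Integrable fun x =>
      (ψ x * fderiv ℝ χ x (EuclideanSpace.single j (1 : ℝ))) • f x := by
    intro j
    exact hint (hψ.continuous.mul (hcd hχ _)) ((hχc.fderiv_apply (𝕜 := ℝ) _).mul_left) hf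
  have i3 : Integrable fun x => φ x • f x := hint φ.continuous φ.hasCompactSupport hf
  have i4 : Integrable fun x => φ x • q x • f x := hint φ.continuous φ.hasCompactSupport hqf
  have h1 : ∀ j : Fin 3,
      diracCLM j (∫ x, (-fderiv ℝ ψ x (EuclideanSpace.single j (1 : ℝ))) • χ x • f x) =
      diracCLM j (∫ x, (-fderiv ℝ φ x (EuclideanSpace.single j (1 : ℝ))) • f x) +
      ∫ x, diracCLM j ((ψ x * fderiv ℝ χ x (EuclideanSpace.single j (1 : ℝ))) • f x) := by
    intro j
    rw [(diracCLM j).integral_comp_comm (i2 j), ← map_add, ← integral_add (i1 j) (i2 j)]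
    congr 2
    ext1 x
    rw [hdφ, ← add_smul, smul_smul]
    congr 1
    ring
  have h2 : (∫ x, ψ x • ((lam - q x) • χ x • f x + commutatorField χ f x)) =
      lam • (∫ x, φ x • f x) - (∫ x, φ x • q x • f x) +
      ∑ j, ∫ x, diracCLM j ((ψ x * fderiv ℝ χ x (EuclideanSpace.single j (1 : ℝ))) • f x) := by
    have i5 : Integrable fun x => lam • φ x • f x := i3.smul lam
    have i6 : Integrable fun x => lam • φ x • f x - φ x • q x • f x := i5.sub i4
    rw [← integral_finsetSum _ fun j _ => (diracCLM j).integrable_comp (i2 j),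
      ← integral_smul, ← integral_sub i5 i4,
      ← integral_add i6 (integrable_finsetSum _ fun j _ => (diracCLM j).integrable_comp (i2 j))]
    congr 1
    ext1 x
    rw [smul_add, commutatorField, Finset.smul_sum]
    congr 1
    · rw [hφ, smul_smul, smul_smul, smul_smul, smul_smul, ← sub_smul]
      congr 1
      ring
    · refine Finset.sum_congr rfl fun j _ => ?_
      rw [mul_smul]
      exact (((diracCLM j).restrictScalars ℝ).map_smul _ _).symm
  simp only [h1, Finset.sum_add_distrib, h2]
  rw [← key]
  abel

/-- Passage to the complex Schwartz functions needed for Sobolev regularity: real and imaginary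
parts are smooth, and `weak_dirac_cutoff` asks for no decay of the test function. -/
lemma weak_dirac_cutoff_schwartz {q : Space → ℝ} {lam : ℝ} {f : Space → Spinor}
    (hf : LocallyIntegrable f)
    (hqf : LocallyIntegrable (fun x => q x • f x))
    (heq : diracExpr q f = lam • toDistribution f)
    {χ : Space → ℝ} (hχ : ContDiff ℝ ∞ χ) (hχc : HasCompactSupport χ)
    (hu : MemLp (fun x => χ x • f x) 2)
    (hw : MemLp (fun x => (lam - q x) • χ x • f x + commutatorField χ f x) 2)
    (φ : 𝓢(Space, ℂ)) :
    ∑ j, diracCLM j (∫ x, (-∂_{EuclideanSpace.single j (1 : ℝ)} φ : 𝓢(Space, ℂ)) x • χ x • f x) =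
      ∫ x, φ x • ((lam - q x) • χ x • f x + commutatorField χ f x) := by
  have hsplit : ∀ (ζ : 𝓢(Space, ℂ)) {g : Space → Spinor} (_ : MemLp g 2),
      ∫ x, ζ x • g x = (∫ x, (ζ x).re • g x) + Complex.I • ∫ x, (ζ x).im • g x := by
    intro ζ g hg
    have hre : MemLp (fun x => (ζ x).re) 2 := (ζ.memLp 2).re
    have him : MemLp (fun x => (ζ x).im) 2 := (ζ.memLp 2).im
    have h1 : Integrable fun x => (ζ x).re • g x := memLp_one_iff_integrable.1 (hg.smul hre)
    have h2 : Integrable fun x => (ζ x).im • g x := memLp_one_iff_integrable.1 (hg.smul him)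
    have h3 : Integrable fun x => Complex.I • (ζ x).im • g x := h2.smul Complex.I
    rw [← integral_smul, ← integral_add h1 h3]
    congr 1
    ext1 x
    rw [← Complex.coe_smul, ← Complex.coe_smul, smul_smul, ← add_smul, mul_comm,
      Complex.re_add_im]
  have hre : ContDiff ℝ ∞ (fun x => (φ x).re) := Complex.reCLM.contDiff.comp (φ.smooth ⊤)
  have him : ContDiff ℝ ∞ (fun x => (φ x).im) := Complex.imCLM.contDiff.comp (φ.smooth ⊤)
  have hdre : ∀ x v, ((-∂_{v} φ : 𝓢(Space, ℂ)) x).re = -fderiv ℝ (fun x => (φ x).re) x v := by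
    intro x v
    have := (Complex.reCLM.hasFDerivAt.comp x (φ.differentiableAt (x := x)).hasFDerivAt).fderiv
    have h' : fderiv ℝ (fun x => (φ x).re) x = Complex.reCLM.comp (fderiv ℝ φ x) := this
    rw [h', neg_apply, SchwartzMap.lineDerivOp_apply_eq_fderiv]
    simp
  have hdim : ∀ x v, ((-∂_{v} φ : 𝓢(Space, ℂ)) x).im = -fderiv ℝ (fun x => (φ x).im) x v := by
    intro x v
    have := (Complex.imCLM.hasFDerivAt.comp x (φ.differentiableAt (x := x)).hasFDerivAt).fderiv
    have h' : fderiv ℝ (fun x => (φ x).im) x = Complex.imCLM.comp (fderiv ℝ φ x) := this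
    rw [h', neg_apply, SchwartzMap.lineDerivOp_apply_eq_fderiv]
    simp
  rw [hsplit φ hw, ← weak_dirac_cutoff hf hqf heq hχ hχc hre,
    ← weak_dirac_cutoff hf hqf heq hχ hχc him, Finset.smul_sum, ← Finset.sum_add_distrib]
  refine Finset.sum_congr rfl fun j _ => ?_
  rw [hsplit _ hu, map_add, map_smul]
  simp only [hdre, hdim]

end WeakForm

/-! ### Membership of cut-offs in the domain and the resolvent estimate -/

section Cutoff

open scoped SchwartzMap ENNReal NNReal ContDiff

lemma IsL2Loc.locallyIntegrable {q : Space → ℝ} (hq : IsL2Loc q) : LocallyIntegrable q := by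
  rw [locallyIntegrable_iff]
  intro K hK
  have : IsFiniteMeasure (volume.restrict K) := ⟨by simpa using hK.measure_lt_top⟩
  exact memLp_one_iff_integrable.1 ((hq K hK).mono_exponent (by norm_num))

lemma IsPolynomiallyBounded.exists_continuous_bound {f : Space → Spinor}
    (hf : IsPolynomiallyBounded f) :
    ∃ b : Space → ℝ, Continuous b ∧ ∀ᵐ x, ‖f x‖ ≤ b x := by
  obtain ⟨C, N, h⟩ := hf
  exact ⟨fun x => C * (1 + ‖x‖) ^ N, by fun_prop, h⟩

lemma memLp_smul_of_hasCompactSupport {f : Space → Spinor} (hm : AEStronglyMeasurable f)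
    (hf : IsPolynomiallyBounded f) {χ : Space → ℝ} (hχ : Continuous χ) (hχc : HasCompactSupport χ)
    (p : ℝ≥0∞) : MemLp (fun x => χ x • f x) p := by
  obtain ⟨b, hb, hfb⟩ := hf.exists_continuous_bound
  have h : MemLp (fun x => χ x * b x) p :=
    (hχ.mul hb).memLp_of_hasCompactSupport hχc.mul_right
  refine h.mono (hχ.aestronglyMeasurable.smul hm) ?_
  filter_upwards [hfb] with x hx
  rw [norm_smul, norm_mul]
  gcongr
  exact hx.trans (le_abs_self _)

lemma locallyIntegrable_of_bounded {f : Space → Spinor} (hm : AEStronglyMeasurable f)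
    (hf : IsPolynomiallyBounded f) : LocallyIntegrable f := by
  obtain ⟨b, hb, hfb⟩ := hf.exists_continuous_bound
  refine hb.locallyIntegrable.mono hm ?_
  filter_upwards [hfb] with x hx
  exact hx.trans (le_abs_self _)

lemma IsL2Loc.locallyIntegrable_smul_of_bounded {q : Space → ℝ} (hq : IsL2Loc q)
    {f : Space → Spinor} (hm : AEStronglyMeasurable f) (hf : IsPolynomiallyBounded f) :
    LocallyIntegrable fun x => q x • f x := by
  obtain ⟨b, hb, hfb⟩ := hf.exists_continuous_bound
  have h : LocallyIntegrable fun x => q x * b x := by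
    rw [locallyIntegrable_iff]
    intro K hK
    exact (hq.locallyIntegrable.integrableOn_isCompact hK).mul_continuousOn hb.continuousOn hK
  refine h.mono (hq.locallyIntegrable.aestronglyMeasurable.smul hm) ?_
  filter_upwards [hfb] with x hx
  rw [norm_smul, norm_mul]
  gcongr
  exact hx.trans (le_abs_self _)

/-- On the support of `χ`, `q` is in `L²` and `χ f` is bounded: Hölder with exponents `2` and `∞`.
-/
lemma IsL2Loc.memLp_smul {q : Space → ℝ} (hq : IsL2Loc q)
    {f : Space → Spinor} (hm : AEStronglyMeasurable f) (hf : IsPolynomiallyBounded f)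
    {χ : Space → ℝ} (hχ : Continuous χ) (hχc : HasCompactSupport χ) :
    MemLp (fun x => q x • χ x • f x) 2 := by
  have h1 : MemLp ((tsupport χ).indicator q) 2 :=
    (memLp_indicator_iff_restrict (isClosed_tsupport χ).measurableSet).2 (hq _ hχc)
  have h2 := memLp_smul_of_hasCompactSupport hm hf hχ hχc ⊤
  have h3 : MemLp ((tsupport χ).indicator q • fun x => χ x • f x) 2 := h2.smul h1
  convert h3 using 1
  ext1 x
  by_cases hx : x ∈ tsupport χ
  · simp [hx]
  · simp [image_eq_zero_of_notMem_tsupport hx]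

lemma memLp_commutatorField {f : Space → Spinor} (hm : AEStronglyMeasurable f)
    (hf : IsPolynomiallyBounded f) {χ : Space → ℝ} (hχ : ContDiff ℝ ∞ χ)
    (hχc : HasCompactSupport χ) : MemLp (commutatorField χ f) 2 := by
  refine memLp_finsetSum _ fun j _ => ?_
  refine (diracCLM j).comp_memLp' (memLp_smul_of_hasCompactSupport hm hf ?_ ?_ 2)
  · exact (hχ.continuous_fderiv (by simp)).clm_apply continuous_const
  · exact hχc.fderiv_apply (𝕜 := ℝ) _

/-- Caccioppoli-type inequality: if `λ` is in the resolvent set of `H`, then cut-offs of a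
generalized eigenfunction are controlled by the commutator with the cut-off. -/
theorem exists_eLpNorm_cutoff_le {q : Space → ℝ} (hq : IsL2Loc q) {lam : ℝ} {f : Space → Spinor}
    (hm : AEStronglyMeasurable f) (hf : IsPolynomiallyBounded f)
    (heq : diracExpr q f = lam • toDistribution f) {H : L2 →ₗ.[ℂ] L2}
    (hH : IsSelfAdjointRealization q H)
    (hdom : ∀ u : L2, MemH1 u → MemDomMul q u → u ∈ H.domain)
    (hres : InResolventSet H (lam : ℂ)) :
    ∃ K : ℝ≥0, ∀ χ : Space → ℝ, ContDiff ℝ ∞ χ → HasCompactSupport χ →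
      eLpNorm (fun x => χ x • f x) 2 ≤ K * eLpNorm (commutatorField χ f) 2 := by
  obtain ⟨R, -, hR⟩ := hres
  refine ⟨‖R‖₊, fun χ hχ hχc => ?_⟩
  have hfl := locallyIntegrable_of_bounded hm hf
  have hqfl := hq.locallyIntegrable_smul_of_bounded hm hf
  have hu := memLp_smul_of_hasCompactSupport hm hf hχ.continuous hχc 2
  have hqu := hq.memLp_smul hm hf hχ.continuous hχc
  have hv := memLp_commutatorField hm hf hχ hχc
  have hw : MemLp (fun x => (lam - q x) • χ x • f x + commutatorField χ f x) 2 := by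
    have h : MemLp (fun x => lam • χ x • f x - q x • χ x • f x + commutatorField χ f x) 2 :=
      ((hu.const_smul lam).sub hqu).add hv
    simpa only [sub_smul] using h
  set u : L2 := hu.toLp _ with hudef
  have hu_ae : u =ᵐ[volume] fun x => χ x • f x := hu.coeFn_toLp
  have hH1 : MemH1 u := by
    refine memH1_of_dirac (w := hw.toLp _) fun φ => ?_
    simp only [Lp.toTemperedDistribution_apply]
    rw [integral_congr_ae (g := fun x => φ x • ((lam - q x) • χ x • f x + commutatorField χ f x))
      (by filter_upwards [hw.coeFn_toLp] with x hx; rw [hx]),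
      ← weak_dirac_cutoff_schwartz hfl hqfl heq hχ hχc hu hw φ]
    refine Finset.sum_congr rfl fun j _ => congrArg _ (integral_congr_ae ?_)
    filter_upwards [hu_ae] with x hx
    rw [hx]
  have hqu' : MemLp (fun x => q x • u x) 2 := by
    refine hqu.ae_eq ?_
    filter_upwards [hu_ae] with x hx
    rw [hx]
  have hmem : u ∈ H.domain := hdom u hH1 hqu'
  have hul : LocallyIntegrable u := (Lp.memLp u).locallyIntegrable (by norm_num)
  have happ := hH.apply_eq ⟨u, hmem⟩
  -- Both sides are locally integrable, so testing against smooth compactly supported functions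
  -- suffices; the terms in `q` cancel.
  have hHu : (H ⟨u, hmem⟩ : L2) =ᵐ[volume] fun x => lam • χ x • f x + commutatorField χ f x := by
    refine ae_eq_of_integral_contDiff_smul_eq
      ((Lp.memLp _).locallyIntegrable (by norm_num))
      (((hu.const_smul lam).add hv).locallyIntegrable (by norm_num)) fun g hg hgc => ?_
    let φ : 𝓓((⊤ : TopologicalSpace.Opens Space), ℝ) := ⟨g, hg, hgc, by simp⟩
    have h1 := congrArg (fun T : SpinorDistribution => T φ) happ
    simp only at h1
    rw [toDistribution_apply ((Lp.memLp _).locallyIntegrable (by norm_num)),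
      diracExpr_apply hul (hqu'.locallyIntegrable (by norm_num))] at h1
    have hφ : (φ : Space → ℝ) = g := rfl
    rw [hφ] at h1
    rw [h1]
    have h2 := weak_dirac_cutoff hfl hqfl heq hχ hχc hg
    have h3 : ∀ j : Fin 3,
        ∫ x, (-fderiv ℝ g x (EuclideanSpace.single j (1 : ℝ))) • (u : Space → Spinor) x =
        ∫ x, (-fderiv ℝ g x (EuclideanSpace.single j (1 : ℝ))) • χ x • f x := by
      refine fun j => integral_congr_ae ?_
      filter_upwards [hu_ae] with x hx
      rw [hx]
    have h4 : ∫ x, g x • q x • (u : Space → Spinor) x = ∫ x, g x • q x • χ x • f x := by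
      refine integral_congr_ae ?_
      filter_upwards [hu_ae] with x hx
      rw [hx]
    simp only [h3]
    rw [h2, h4, ← integral_add]
    · congr 1
      ext1 x
      rw [← smul_add, sub_smul]
      congr 1
      abel
    · exact (hw.locallyIntegrable (by norm_num)).integrable_smul_left_of_hasCompactSupport
        hg.continuous hgc
    · exact (hqu.locallyIntegrable (by norm_num)).integrable_smul_left_of_hasCompactSupport
        hg.continuous hgc
  -- The left-inverse identity recovers `u` from `(H - λ) u`, which is the commutator field.
  have hRu := hR ⟨u, hmem⟩
  have hdiff : H ⟨u, hmem⟩ - (lam : ℂ) • u = hv.toLp _ := by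
    refine Lp.ext ?_
    filter_upwards [Lp.coeFn_sub (H ⟨u, hmem⟩) ((lam : ℂ) • u), Lp.coeFn_smul (lam : ℂ) u, hHu,
      hu_ae, hv.coeFn_toLp] with x h1 h2 h3 h4 h5
    rw [h1, h5, Pi.sub_apply, h2, h3, Pi.smul_apply, h4, Complex.coe_smul]
    abel
  simp only at hRu
  rw [hdiff] at hRu
  have h : ‖u‖ₑ ≤ ‖R‖₊ * ‖hv.toLp _‖ₑ := by
    rw [← hRu]
    exact R.le_opENorm _
  rwa [Lp.enorm_def, Lp.enorm_def, eLpNorm_congr_ae hu_ae, eLpNorm_congr_ae hv.coeFn_toLp] at h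

end Cutoff

/-! ### Doubling inequality against polynomial growth -/

section Growth

open scoped ENNReal NNReal ContDiff

/-- A nondecreasing function of polynomial growth that satisfies `j R ≤ (A / R) j (2 R)` vanishes. -/
lemma eq_zero_of_le_div_mul_double {j : ℝ → ℝ} (h0 : ∀ R, 0 ≤ j R) (hmono : Monotone j) {A B : ℝ}
    {m : ℕ} (hA : ∀ R, 1 ≤ R → j R ≤ A / R * j (2 * R)) (hB : ∀ R, 1 ≤ R → j R ≤ B * R ^ m)
    {R : ℝ} (hR : 1 ≤ R) : j R = 0 := by
  -- Each use of the doubling inequality gains a factor `1/R`, at the cost of a constant containing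
  -- `2 ^ m` from evaluating the bound at `2 R`.
  have key : ∀ k : ℕ, ∃ C, ∀ R, 1 ≤ R → R ^ k * j R ≤ C * R ^ m := by
    intro k
    induction k with
    | zero => exact ⟨B, by simpa using hB⟩
    | succ k ih =>
      obtain ⟨C, hC⟩ := ih
      refine ⟨|A| * C * 2 ^ m, fun R hR => ?_⟩
      have hR0 : 0 < R := by linarith
      have hj : R * j R ≤ |A| * j (2 * R) := by
        calc R * j R ≤ R * (A / R * j (2 * R)) := by gcongr; exact hA R hR
          _ = A * j (2 * R) := by field_simp
          _ ≤ |A| * j (2 * R) := by gcongr; exacts [h0 _, le_abs_self A]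
      calc R ^ (k + 1) * j R = R ^ k * (R * j R) := by ring
        _ ≤ R ^ k * (|A| * j (2 * R)) := by gcongr
        _ = |A| * (R ^ k * j (2 * R)) := by ring
        _ ≤ |A| * ((2 * R) ^ k * j (2 * R)) := by
          have := h0 (2 * R)
          have : R ≤ 2 * R := by linarith
          gcongr
        _ ≤ |A| * (C * (2 * R) ^ m) :=
          mul_le_mul_of_nonneg_left (hC (2 * R) (by linarith)) (abs_nonneg A)
        _ = |A| * C * 2 ^ m * R ^ m := by rw [mul_pow]; ring
  obtain ⟨C, hC⟩ := key (m + 1)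
  have hS : ∀ S, 1 ≤ S → S * j S ≤ C := by
    intro S hS
    have hS0 : 0 < S ^ m := by positivity
    refine le_of_mul_le_mul_right ?_ hS0
    calc S * j S * S ^ m = S ^ (m + 1) * j S := by ring
      _ ≤ C * S ^ m := hC S hS
  by_contra hne
  have hpos : 0 < j R := lt_of_le_of_ne (h0 R) (Ne.symm hne)
  -- At this radius `S`, monotonicity gives `S * j S ≥ C + j R > C`, against `hS`.
  have hSR : R ≤ max R (C / j R + 1) := le_max_left _ _
  have h1 := hS _ (hR.trans hSR)
  have h2 : (C / j R + 1) * j R ≤ C := by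
    refine le_trans ?_ h1
    exact mul_le_mul (le_max_right _ _) (hmono hSR) hpos.le ((zero_le_one.trans hR).trans hSR)
  rw [add_mul, div_mul_cancel₀ _ hpos.ne'] at h2
  linarith

/-- Dilating one fixed bump of radii `1` and `2` by `R` divides its gradient by `R`, so `c` is
uniform. -/
lemma exists_cutoff : ∃ c : ℝ≥0, ∀ R : ℝ, 1 ≤ R → ∃ χ : Space → ℝ, ContDiff ℝ ∞ χ ∧
    HasCompactSupport χ ∧ (∀ x ∈ Metric.closedBall (0 : Space) R, χ x = 1) ∧
    (∀ x, ‖fderiv ℝ χ x‖ ≤ c / R) ∧ ∀ x ∉ Metric.closedBall (0 : Space) (2 * R),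
      fderiv ℝ χ x = 0 := by
  let χ₀ : ContDiffBump (0 : Space) := ⟨1, 2, one_pos, one_lt_two⟩
  have hc0 : HasCompactSupport (fderiv ℝ χ₀) := χ₀.hasCompactSupport.fderiv (𝕜 := ℝ)
  obtain ⟨c, hc⟩ := hc0.exists_bound_of_continuous
    ((χ₀.contDiff (n := 1)).continuous_fderiv (by simp))
  have hc' : 0 ≤ c := (norm_nonneg _).trans (hc 0)
  lift c to ℝ≥0 using hc'
  refine ⟨c, fun R hR => ⟨fun x => χ₀ (R⁻¹ • x), ?_, ?_, ?_, ?_, ?_⟩⟩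
  · exact χ₀.contDiff.comp (contDiff_const_smul _)
  · exact χ₀.hasCompactSupport.comp_smul (by positivity)
  · intro x hx
    refine χ₀.one_of_mem_closedBall ?_
    rw [mem_closedBall_zero_iff] at hx ⊢
    rw [norm_smul, norm_inv, Real.norm_of_nonneg (by positivity)]
    exact (inv_mul_le_one₀ (by positivity)).2 hx
  · intro x
    rw [fderiv_comp_smul, norm_smul, norm_inv, Real.norm_of_nonneg (by positivity)]
    rw [inv_mul_eq_div]
    gcongr
    exact hc _
  · intro x hx
    rw [fderiv_comp_smul, image_eq_zero_of_notMem_tsupport (f := fderiv ℝ χ₀), smul_zero]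
    intro h
    have h1 := tsupport_fderiv_subset ℝ h
    rw [χ₀.tsupport_eq, mem_closedBall_zero_iff, norm_smul, norm_inv,
      Real.norm_of_nonneg (by positivity), inv_mul_le_iff₀ (by positivity)] at h1
    rw [mem_closedBall_zero_iff] at hx
    apply hx
    rw [mul_comm]
    exact h1

lemma norm_commutatorField_le (χ : Space → ℝ) (f : Space → Spinor) (x : Space) :
    ‖commutatorField χ f x‖ ≤ (∑ j, ‖diracCLM j‖) * ‖fderiv ℝ χ x‖ * ‖f x‖ := by
  rw [commutatorField, Finset.sum_mul, Finset.sum_mul]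
  refine norm_sum_le_of_le _ fun j _ => ((diracCLM j).le_opNorm _).trans ?_
  rw [norm_smul, mul_assoc]
  gcongr
  refine ((fderiv ℝ χ x).le_opNorm _).trans ?_
  simp

/-- The `L²` norm of `f` over the ball of radius `R`. -/
def ballNorm (f : Space → Spinor) (R : ℝ) : ℝ≥0∞ :=
  eLpNorm f 2 (volume.restrict (Metric.closedBall 0 R))

lemma ballNorm_mono (f : Space → Spinor) : Monotone (ballNorm f) := fun _ _ h =>
  eLpNorm_mono_measure _ (Measure.restrict_mono (Metric.closedBall_subset_closedBall h) le_rfl)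

lemma exists_ballNorm_le_pow {f : Space → Spinor} (hf : IsPolynomiallyBounded f) :
    ∃ (B : ℝ≥0) (m : ℕ), ∀ R, 1 ≤ R → ballNorm f R ≤ ENNReal.ofReal (B * R ^ m) := by
  obtain ⟨C, N, h⟩ := hf
  set V : ℝ≥0∞ := volume (Metric.closedBall (0 : Space) 1) with hV
  have hVt : V ≠ ⊤ := measure_closedBall_lt_top.ne
  -- On the ball `1 + |x| ≤ 2 R`, giving `2 ^ N`; the square root of the volume contributes `R ^
  -- (3/2)`, bounded crudely by `R ^ 2`.
  refine ⟨(V ^ (1 / 2 : ℝ)).toNNReal * (‖C‖₊ * 2 ^ N), N + 2, fun R hR => ?_⟩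
  have hb : ∀ᵐ x ∂(volume.restrict (Metric.closedBall (0 : Space) R)),
      ‖f x‖ ≤ |C| * (2 * R) ^ N := by
    filter_upwards [ae_restrict_of_ae h, ae_restrict_mem Metric.isClosed_closedBall.measurableSet]
      with x hx hxR
    rw [mem_closedBall_zero_iff] at hxR
    refine hx.trans ?_
    gcongr
    · exact le_abs_self C
    · linarith
  refine (eLpNorm_le_of_ae_bound hb).trans ?_
  rw [Measure.restrict_apply_univ, Measure.addHaar_closedBall' _ _ (by positivity)]
  have h3 : Module.finrank ℝ Space = 3 := by simp
  rw [h3, ENNReal.mul_rpow_of_nonneg _ _ (by norm_num), ← hV,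
    ENNReal.ofReal_rpow_of_nonneg (by positivity) (by norm_num)]
  have hV2 : V ^ ((2 : ℝ≥0∞).toReal⁻¹) = ENNReal.ofReal (V ^ (1 / 2 : ℝ)).toReal := by
    rw [ENNReal.ofReal_toReal (ENNReal.rpow_ne_top_of_nonneg (by norm_num) hVt)]
    norm_num
  have hR2 : (R ^ 3) ^ ((2 : ℝ≥0∞).toReal⁻¹) ≤ R ^ 2 := by
    calc (R ^ 3) ^ ((2 : ℝ≥0∞).toReal⁻¹) ≤ (R ^ 4) ^ ((2 : ℝ≥0∞).toReal⁻¹) := by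
          gcongr
          norm_num
      _ = R ^ 2 := by
          rw [show R ^ 4 = (R ^ 2) ^ (2 : ℝ) by norm_num; ring, ENNReal.toReal_ofNat,
            Real.rpow_rpow_inv (by positivity) (by norm_num)]
  rw [hV2, ← ENNReal.ofReal_mul (by positivity), ← ENNReal.ofReal_mul (by positivity)]
  refine ENNReal.ofReal_le_ofReal ?_
  calc _ ≤ R ^ 2 * (V ^ (1 / 2 : ℝ)).toReal * (|C| * (2 * R) ^ N) := by gcongr
    _ = _ := by
      simp only [NNReal.coe_mul, NNReal.coe_pow, NNReal.coe_ofNat, coe_nnnorm, Real.norm_eq_abs,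
        ENNReal.coe_toNNReal_eq_toReal, mul_pow, pow_add]
      ring

lemma exists_ballNorm_le_double {f : Space → Spinor} {K : ℝ≥0}
    (hK : ∀ χ : Space → ℝ, ContDiff ℝ ∞ χ → HasCompactSupport χ →
      eLpNorm (fun x => χ x • f x) 2 ≤ K * eLpNorm (commutatorField χ f) 2) :
    ∃ A : ℝ≥0, ∀ R, 1 ≤ R → ballNorm f R ≤ ENNReal.ofReal (A / R) * ballNorm f (2 * R) := by
  obtain ⟨c, hc⟩ := exists_cutoff
  obtain ⟨M, hM⟩ : ∃ M : ℝ≥0, (M : ℝ) = ∑ j, ‖diracCLM j‖ :=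
    ⟨∑ j, ‖diracCLM j‖₊, by simp⟩
  refine ⟨K * (M * c), fun R hR => ?_⟩
  obtain ⟨χ, hχ, hχc, hχ1, hdχ, hdχ0⟩ := hc R hR
  have h1 : ballNorm f R ≤ eLpNorm (fun x => χ x • f x) 2 := by
    rw [ballNorm, eLpNorm_congr_ae (g := fun x => χ x • f x)]
    · exact eLpNorm_mono_measure _ Measure.restrict_le_self
    · filter_upwards [ae_restrict_mem Metric.isClosed_closedBall.measurableSet] with x hx
      rw [hχ1 x hx, one_smul]
  have h2 : eLpNorm (commutatorField χ f) 2 =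
      eLpNorm (commutatorField χ f) 2 (volume.restrict (Metric.closedBall 0 (2 * R))) := by
    refine (eLpNorm_restrict_eq_of_support_subset fun x hx => ?_).symm
    by_contra hx'
    apply hx
    simp [commutatorField, hdχ0 x hx']
  have h3 : eLpNorm (commutatorField χ f) 2 ≤ ENNReal.ofReal (M * (c / R)) * ballNorm f (2 * R) := by
    rw [h2]
    refine eLpNorm_le_mul_eLpNorm_of_ae_le_mul (ae_of_all _ fun x => ?_) 2
    refine (norm_commutatorField_le χ f x).trans ?_
    rw [← hM]
    gcongr
    exact hdχ x
  have h4 : (K : ℝ≥0∞) * ENNReal.ofReal (M * (c / R)) = ENNReal.ofReal ((K * (M * c) : ℝ≥0) / R) := by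
    rw [← ENNReal.ofReal_coe_nnreal, ← ENNReal.ofReal_mul K.coe_nonneg, NNReal.coe_mul,
      NNReal.coe_mul, mul_div_assoc, mul_div_assoc]
  rw [← h4, mul_assoc]
  exact (h1.trans (hK χ hχ hχc)).trans (mul_le_mul_right h3 _)

lemma ae_eq_zero_of_cutoff_le {f : Space → Spinor} (hm : AEStronglyMeasurable f)
    (hf : IsPolynomiallyBounded f) {K : ℝ≥0}
    (hK : ∀ χ : Space → ℝ, ContDiff ℝ ∞ χ → HasCompactSupport χ →
      eLpNorm (fun x => χ x • f x) 2 ≤ K * eLpNorm (commutatorField χ f) 2) :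
    f =ᵐ[volume] 0 := by
  obtain ⟨B, m, hB⟩ := exists_ballNorm_le_pow hf
  obtain ⟨A, hA⟩ := exists_ballNorm_le_double hK
  have htop : ∀ R, ballNorm f R ≠ ⊤ := fun R =>
    ne_top_of_le_ne_top ENNReal.ofReal_ne_top
      ((ballNorm_mono f (le_max_left R 1)).trans (hB _ (le_max_right R 1)))
  have hzero : ∀ R, 1 ≤ R → (ballNorm f R).toReal = 0 := fun R hR => by
    refine eq_zero_of_le_div_mul_double (j := fun R => (ballNorm f R).toReal) (A := A) (B := B)
      (m := m) (fun _ => ENNReal.toReal_nonneg)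
      (fun S T h => ENNReal.toReal_mono (htop T) (ballNorm_mono f h)) (fun S hS => ?_)
      (fun S hS => ?_) hR
    · have := ENNReal.toReal_mono (ENNReal.mul_ne_top ENNReal.ofReal_ne_top (htop _)) (hA S hS)
      rwa [ENNReal.toReal_mul, ENNReal.toReal_ofReal (by positivity)] at this
    · have := ENNReal.toReal_mono ENNReal.ofReal_ne_top (hB S hS)
      rwa [ENNReal.toReal_ofReal (by positivity)] at this
  -- The shift to `n + 1` keeps every radius at least `1`, as `hzero` requires.
  have hn : ∀ n : ℕ, ∀ᵐ x, x ∈ Metric.closedBall (0 : Space) (n + 1) → f x = 0 := by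
    intro n
    have h := ((ENNReal.toReal_eq_zero_iff _).1 (hzero (n + 1) (by simp))).resolve_right (htop _)
    rw [ballNorm, eLpNorm_eq_zero_iff hm.restrict (by norm_num)] at h
    exact (ae_restrict_iff' Metric.isClosed_closedBall.measurableSet).1 h
  filter_upwards [ae_all_iff.2 hn] with x hx
  obtain ⟨n, hxn⟩ := exists_nat_ge ‖x‖
  exact hx n (mem_closedBall_zero_iff.2 (hxn.trans (by simp)))

end Growth

end MasslessDirac

end

theorem theorem3p1 (q : MasslessDirac.Space → ℝ) (hq : MasslessDirac.IsL2Loc q) (lam : ℝ)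
    (f : MasslessDirac.Space → MasslessDirac.Spinor)
    (hf_meas : AEStronglyMeasurable f (volume : Measure MasslessDirac.Space))
    (hf_poly : MasslessDirac.IsPolynomiallyBounded f)
    (hf_ne : ¬ f =ᵐ[(volume : Measure MasslessDirac.Space)] 0)
    (hf_eq : MasslessDirac.diracExpr q f = lam • MasslessDirac.toDistribution f)
    (H : MasslessDirac.L2 →ₗ.[ℂ] MasslessDirac.L2)
    (hH : MasslessDirac.IsSelfAdjointRealization q H)
    (hdom : ∀ u : MasslessDirac.L2,
      MasslessDirac.MemH1 u → MasslessDirac.MemDomMul q u → u ∈ H.domain) :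
    (lam : ℂ) ∈ MasslessDirac.opSpectrum H := by
  intro hres
  obtain ⟨K, hK⟩ :=
    MasslessDirac.exists_eLpNorm_cutoff_le hq hf_meas hf_poly hf_eq hH hdom hres
  exact hf_ne (MasslessDirac.ae_eq_zero_of_cutoff_le hf_meas hf_poly hK)
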